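/- Let $K_0(\mathrm{Var}_{\mathbb C})$ be the Grothendieck ring of complex varieties (separated schemes of finite type over $\mathbb C$): the free abelian group on isomorphism classes $[X]$ modulo the relations $[X]=[X_{\mathrm{red}}]$ and $[X]=[U]+[X\setminus U]$ for $U\subseteq X$ open, with product $[X]\cdot[Y]=[X\times_{\mathbb C} Y]$; put $\mathbb L=[\mathbb A^1_{\mathbb C}]$. For a finite group $G$ acting on an affine variety $\operatorname{Spec} A$ by $\mathbb C$-automorphisms, the quotient is $(\operatorname{Spec} A)/G=\operatorname{Spec}(A^G)$. Let $n\ge 0$ and let $G\subseteq \mathrm{GL}_n(\mathbb C)$ be a finite group. (1) If all elements of $G$ are diagonal matrices (so that $G$ is abelian and acts on $(\mathbb C^*)^n\subseteq\mathbb C^n$), then the variety $(\mathbb C^*)^n/G$ is isomorphic over $\mathbb C$ to $(\mathbb C^*)^n$, and $[(\mathbb C^*)^n/G]=(\mathbb L-1)^n$ in $K_0(\mathrm{Var}_{\mathbb C})$. (2) If $G$ is abelian (not necessarily diagonal), then $[\mathbb C^n/G]=\mathbb L^n$ in $K_0(\mathrm{Var}_{\mathbb C})$, where $G$ acts linearly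 on $\mathbb C^n$. -/

import Mathlib

noncomputable section

open AlgebraicGeometry CategoryTheory MonoidalCategory

universe u

namespace MotivicClass

/-! ### Varieties over a field -/

/-- A variety over `k` is a separated scheme of finite type over `Spec k`. -/
def isVariety (k : Type u) [Field k] : ObjectProperty (Over (Spec (CommRingCat.of k))) :=
  fun X => LocallyOfFiniteType X.hom ∧ QuasiCompact X.hom ∧ IsSeparated X.hom

/-- The category of `k`-varieties, with all `k`-morphisms. -/
abbrev Var (k : Type u) [Field k] := (isVariety k).FullSubcategory

/-- `Spec k` is a variety and varieties are stable under products over `Spec k`. Hence `Var k`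
is a symmetric monoidal category, the tensor product being the fibre product over `Spec k`. -/
instance isVariety_isMonoidal (k : Type u) [Field k] : (isVariety k).IsMonoidal where
  prop_unit := by
    have : (𝟙_ (Over (Spec (CommRingCat.of k)))).hom = 𝟙 _ := rfl
    refine ⟨?_, ?_, ?_⟩ <;> rw [this] <;> infer_instance
  prop_tensor X Y hX hY := by
    obtain ⟨_, _, _⟩ := hX
    obtain ⟨_, _, _⟩ := hY
    refine ⟨?_, ?_, ?_⟩ <;> rw [Over.tensorObj_hom] <;> infer_instance

/-! ### The Grothendieck ring of varieties -/

/-- The free abelian group on the isomorphism classes of `k`-varieties. It is a commutative ring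
with multiplication induced by `[X] * [Y] = [X × Y]` (product over `Spec k`). -/
abbrev FreeVar (k : Type u) [Field k] := FreeAbelianGroup (Skeleton (Var k))

/-- The basis element of `FreeVar k` given by the isomorphism class of `X`. -/
def freeClass {k : Type u} [Field k] (X : Var k) : FreeVar k := FreeAbelianGroup.of (toSkeleton X)

/-- The defining relations of the Grothendieck ring (isomorphic varieties are already identified):
* `[X] - [X_red]`;
* `[X] - [U] - [X \ U]` for `U ⊆ X` open, with the reduced structure on the closed set `X \ U`.
-/
inductive Rel {k : Type u} [Field k] : FreeVar k → Prop
  | red {X Y : Var k} (i : Y ⟶ X) (hi : IsClosedImmersion i.hom.left)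
      (hs : Surjective i.hom.left) (hY : IsReduced Y.obj.left) :
      Rel (freeClass X - freeClass Y)
  | scissors {X U Z : Var k} (j : U ⟶ X) (i : Z ⟶ X) (hj : IsOpenImmersion j.hom.left)
      (hi : IsClosedImmersion i.hom.left) (hZ : IsReduced Z.obj.left)
      (hc : Set.range i.hom.left = (Set.range j.hom.left)ᶜ) :
      Rel (freeClass X - freeClass U - freeClass Z)

/-- The subgroup of `FreeVar k` generated by the defining relations. -/
def relSubgroup (k : Type u) [Field k] : AddSubgroup (FreeVar k) :=
  AddSubgroup.closure {a | Rel a}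

lemma isReduced_nilradical_subscheme (X : Scheme.{u}) : IsReduced X.nilradical.subscheme := by
  have (U : X.nilradical.subschemeCover.openCover.I₀) :
      IsReduced (X.nilradical.subschemeCover.openCover.X U) := by
    let U : X.affineOpens := U
    change IsReduced (Spec (CommRingCat.of (Γ(X, U) ⧸ X.nilradical.ideal U)))
    have : _root_.IsReduced (Γ(X, U) ⧸ X.nilradical.ideal U) :=
      (Ideal.isRadical_iff_quotient_reduced _).mp (Ideal.radical_isRadical _)
    infer_instance
  exact IsReduced.of_openCover _ X.nilradical.subschemeCover.openCover

section Relations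

variable {k : Type u} [Field k]

lemma exists_reduction (X : Var k) : ∃ (Y : Var k) (i : Y ⟶ X),
    IsClosedImmersion i.hom.left ∧ Surjective i.hom.left ∧ IsReduced Y.obj.left := by
  obtain ⟨X, _, _, _⟩ := X
  let i := X.left.nilradical.subschemeι
  have hY : isVariety k (Over.mk (i ≫ X.hom)) := by
    refine ⟨?_, ?_, ?_⟩ <;> dsimp <;> infer_instance
  refine ⟨⟨Over.mk (i ≫ X.hom), hY⟩, ObjectProperty.homMk (Over.homMk i), ?_, ?_, ?_⟩
  · change IsClosedImmersion i
    infer_instance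
  · change Surjective i
    refine ⟨Set.range_eq_univ.mp ?_⟩
    rw [Scheme.IdealSheafData.range_subschemeι, Scheme.support_nilradical]
    rfl
  · exact isReduced_nilradical_subscheme _

lemma isPullback_whiskerLeft (W : Var k) {X Y : Var k} (f : Y ⟶ X) :
    IsPullback (W ◁ f).hom.left (Limits.pullback.snd W.obj.hom Y.obj.hom)
      (Limits.pullback.snd W.obj.hom X.obj.hom) f.hom.left := by
  refine IsPullback.of_right (h₁₂ := Limits.pullback.fst W.obj.hom X.obj.hom)
    (h₂₂ := X.obj.hom) (v₁₃ := W.obj.hom) ?_ ?_ (IsPullback.of_hasPullback _ _)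
  · have h1 : (W ◁ f).hom.left ≫ Limits.pullback.fst W.obj.hom X.obj.hom =
        Limits.pullback.fst W.obj.hom Y.obj.hom := Over.whiskerLeft_left_fst _
    have h2 : f.hom.left ≫ X.obj.hom = Y.obj.hom := Over.w f.hom
    rw [h1, h2]
    exact IsPullback.of_hasPullback _ _
  · exact Over.whiskerLeft_left_snd _

lemma range_whiskerLeft (W : Var k) {X Y : Var k} (f : Y ⟶ X) :
    Set.range (W ◁ f).hom.left =
      Limits.pullback.snd W.obj.hom X.obj.hom ⁻¹' Set.range f.hom.left := by
  have := Scheme.image_preimage_eq_of_isPullback (isPullback_whiskerLeft W f).flip Set.univ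
  rwa [Set.preimage_univ, Set.image_univ, Set.image_univ] at this

lemma freeClass_tensor (W X : Var k) : freeClass (W ⊗ X) = freeClass W * freeClass X := by
  rw [freeClass, Skeleton.toSkeleton_tensorObj, FreeAbelianGroup.of_mul]; rfl

lemma freeClass_sub_mem {X Y : Var k} (i : Y ⟶ X) (hi : IsClosedImmersion i.hom.left)
    (hs : Surjective i.hom.left) : freeClass X - freeClass Y ∈ relSubgroup k := by
  obtain ⟨Z, j, hj, hjs, hZ⟩ := exists_reduction Y
  have h1 : freeClass Y - freeClass Z ∈ relSubgroup k :=
    AddSubgroup.subset_closure (Rel.red j hj hjs hZ)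
  have h2 : freeClass X - freeClass Z ∈ relSubgroup k := by
    refine AddSubgroup.subset_closure (Rel.red (j ≫ i) ?_ ?_ hZ)
    · change IsClosedImmersion (j.hom.left ≫ i.hom.left); infer_instance
    · change Surjective (j.hom.left ≫ i.hom.left); infer_instance
  simpa using sub_mem h2 h1

lemma mul_rel_mem (W : Var k) {a : FreeVar k} (ha : Rel a) :
    freeClass W * a ∈ relSubgroup k := by
  cases ha with
  | @red X Y i hi hs hY =>
    rw [mul_sub, ← freeClass_tensor, ← freeClass_tensor]
    have h := isPullback_whiskerLeft W i
    exact freeClass_sub_mem (W ◁ i)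
      (MorphismProperty.of_isPullback h.flip hi) (MorphismProperty.of_isPullback h.flip hs)
  | @scissors X U Z j i hj hi hZ hc =>
    rw [mul_sub, mul_sub, ← freeClass_tensor, ← freeClass_tensor, ← freeClass_tensor]
    have hi' : IsClosedImmersion (W ◁ i).hom.left :=
      MorphismProperty.of_isPullback (isPullback_whiskerLeft W i).flip hi
    have hj' : IsOpenImmersion (W ◁ j).hom.left :=
      MorphismProperty.of_isPullback (isPullback_whiskerLeft W j).flip hj
    obtain ⟨T, t, ht, hts, hT⟩ := exists_reduction (W ⊗ Z)
    have h1 : freeClass (W ⊗ Z) - freeClass T ∈ relSubgroup k :=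
      AddSubgroup.subset_closure (Rel.red t ht hts hT)
    have h2 : freeClass (W ⊗ X) - freeClass (W ⊗ U) - freeClass T ∈ relSubgroup k := by
      refine AddSubgroup.subset_closure (Rel.scissors (W ◁ j) (t ≫ W ◁ i) hj' ?_ hT ?_)
      · change IsClosedImmersion (t.hom.left ≫ (W ◁ i).hom.left); infer_instance
      · have : Set.range (t ≫ W ◁ i).hom.left = Set.range (W ◁ i).hom.left := by
          change Set.range (t.hom.left ≫ (W ◁ i).hom.left) = _
          rw [Scheme.Hom.comp_base, TopCat.coe_comp, Set.range_comp,
            Set.range_eq_univ.mpr hts.surj, Set.image_univ]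
        rw [this, range_whiskerLeft, range_whiskerLeft, hc, Set.preimage_compl]
    have := sub_mem h2 h1
    rwa [sub_sub_sub_cancel_right] at this

end Relations

/-- The subgroup generated by the relations is an ideal. -/
def relIdeal (k : Type u) [Field k] : Ideal (FreeVar k) where
  __ := relSubgroup k
  smul_mem' b a ha := by
    change b * a ∈ relSubgroup k
    have key (W : Var k) : freeClass W * a ∈ relSubgroup k := by
      have ha' : a ∈ relSubgroup k := ha
      unfold relSubgroup at ha'
      induction ha' using AddSubgroup.closure_induction with
      | mem x hx => exact mul_rel_mem W hx
      | zero => simp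
      | add x y hx' hy' hx hy => rw [mul_add]; exact add_mem (hx hx') (hy hy')
      | neg x hx' hx => rw [mul_neg]; exact neg_mem (hx hx')
    induction b using FreeAbelianGroup.induction_on with
    | zero => simp
    | of w =>
      obtain ⟨W, rfl⟩ := Quotient.exists_rep w
      exact key W
    | neg w h => rw [neg_mul]; exact neg_mem h
    | add x y hx hy => rw [add_mul]; exact add_mem hx hy

/-- The Grothendieck ring `K₀(Var_k)` of `k`-varieties. -/
abbrev K0 (k : Type u) [Field k] := FreeVar k ⧸ relIdeal k

/-- The class `[X]` of a variety in the Grothendieck ring. -/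
def K0.cls {k : Type u} [Field k] (X : Var k) : K0 k := Ideal.Quotient.mk (relIdeal k) (freeClass X)

/-! ### Affine varieties and quotients by finite groups -/

/-- The affine variety `Spec A` of a finitely generated commutative `k`-algebra `A`. -/
def specVar (k : Type u) [Field k] (A : Type u) [CommRing A] [Algebra k A]
    [Algebra.FiniteType k A] : Var k where
  obj := Over.mk (Spec.map (CommRingCat.ofHom (algebraMap k A)))
  property := by
    have : LocallyOfFiniteType (Spec.map (CommRingCat.ofHom (algebraMap k A))) := by
      rw [HasRingHomProperty.Spec_iff (P := @LocallyOfFiniteType)]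
      simpa [RingHom.finiteType_algebraMap] using (inferInstance : Algebra.FiniteType k A)
    refine ⟨this, ?_, ?_⟩ <;> dsimp <;> infer_instance

section Quotient

variable {k : Type u} [Field k] {A : Type u} [CommRing A] [Algebra k A] {G : Type*} [Group G]

/-- The algebra of invariants `A ^ G` of an action of `G` on `A` by `k`-algebra maps. -/
def invariants (ρ : G →* (A →ₐ[k] A)) : Subalgebra k A where
  carrier := {a | ∀ g, ρ g a = a}
  mul_mem' ha hb g := by rw [map_mul, ha g, hb g]
  add_mem' ha hb g := by rw [map_add, ha g, hb g]
  algebraMap_mem' r g := (ρ g).commutes r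

instance finiteType_invariants [Finite G] [Algebra.FiniteType k A] (ρ : G →* (A →ₐ[k] A)) :
    Algebra.FiniteType k (invariants ρ) := by
  let _ : MulSemiringAction G A :=
    { smul g a := ρ g a
      one_smul a := by change ρ 1 a = a; rw [map_one]; rfl
      mul_smul g h a := by change ρ (g * h) a = ρ g (ρ h a); rw [map_mul]; rfl
      smul_zero g := map_zero (ρ g)
      smul_add g := map_add (ρ g)
      smul_one g := map_one (ρ g)
      smul_mul g := map_mul (ρ g) }
  have : Algebra.IsInvariant (invariants ρ) A G := ⟨fun a ha => ⟨⟨a, ha⟩, rfl⟩⟩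
  have := Algebra.IsInvariant.isIntegral (invariants ρ) A G
  have : Algebra.FiniteType (invariants ρ) A :=
    Algebra.FiniteType.of_restrictScalars_finiteType k (invariants ρ) A
  have : Module.Finite (invariants ρ) A := Algebra.IsIntegral.finite
  exact ⟨fg_of_fg_of_fg k (invariants ρ) A Algebra.FiniteType.out Module.Finite.fg_top
    Subtype.val_injective⟩

/-- The quotient variety `(Spec A) / G = Spec (A ^ G)` of an affine variety by a finite group. -/
def quotientVar [Finite G] [Algebra.FiniteType k A] (ρ : G →* (A →ₐ[k] A)) : Var k :=
  specVar k (invariants ρ)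

end Quotient

/-- Affine space `𝔸ⁿ = Spec k[x₁, …, xₙ]`. -/
def affineSpace (k : Type u) [Field k] (n : ℕ) : Var k := specVar k (MvPolynomial (Fin n) k)

/-- The Lefschetz class `𝕃 = [𝔸¹]`. -/
def lefschetz (k : Type u) [Field k] : K0 k := K0.cls (affineSpace k 1)

/-- The coordinate ring `k[x₁^±1, …, xₙ^±1]` of the torus; the element `single m c` is the
monomial `c * x ^ m`. -/
abbrev Laurent (k : Type u) [Field k] (n : ℕ) := AddMonoidAlgebra k (Fin n → ℤ)

/-- The algebraic torus `(k^*)ⁿ = Spec k[x₁^±1, …, xₙ^±1]`. -/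
def torus (k : Type u) [Field k] (n : ℕ) : Var k := specVar k (Laurent k n)

/-- The action of `GLₙ(k)` on functions on `kⁿ`: `(g • f)(x) = f (g⁻¹ x)`. -/
def linearAction (k : Type u) [Field k] (n : ℕ) :
    GL (Fin n) k →* (MvPolynomial (Fin n) k →ₐ[k] MvPolynomial (Fin n) k) where
  toFun g := MvPolynomial.aeval fun i =>
    ∑ j, MvPolynomial.C ((g⁻¹ : GL (Fin n) k) i j) * MvPolynomial.X j
  map_one' := by
    ext i
    simp [Matrix.one_apply]
  map_mul' g h := by
    apply MvPolynomial.algHom_ext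
    intro i
    simp only [AlgHom.mul_apply, MvPolynomial.aeval_X, map_sum, map_mul,
      mul_inv_rev, Units.val_mul, Matrix.mul_apply, MvPolynomial.algHom_C, Finset.sum_mul,
      Finset.mul_sum, MvPolynomial.algebraMap_eq, mul_assoc]
    exact Finset.sum_comm

/-- The character `x ↦ ∏ xᵢ ^ mᵢ` of `(k^*)ⁿ`, as a function of the exponent `m` and `x`. -/
def monomialValue {k : Type u} [Field k] {n : ℕ} (t : Fin n → kˣ) (m : Fin n → ℤ) : kˣ :=
  ∏ i, t i ^ m i

/-- The action of the group `(k^*)ⁿ` on functions on the torus `(k^*)ⁿ`, induced by translations: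
`(t • f)(x) = f (t⁻¹ x)`, so that `t • x ^ m = (t⁻¹) ^ m x ^ m`. -/
def translationAction (k : Type u) [Field k] (n : ℕ) :
    (Fin n → kˣ) →* (Laurent k n →ₐ[k] Laurent k n) where
  toFun t := AddMonoidAlgebra.lift k (Laurent k n) (Fin n → ℤ)
    { toFun m := AddMonoidAlgebra.single m.toAdd (monomialValue t⁻¹ m.toAdd : k)
      map_one' := by simp [monomialValue, AddMonoidAlgebra.one_def]
      map_mul' m m' := by
        simp [monomialValue, AddMonoidAlgebra.single_mul_single, zpow_add,
          Finset.prod_mul_distrib] }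
  map_one' := by
    ext m
    simp [monomialValue]
  map_mul' s t := by
    apply AddMonoidAlgebra.algHom_ext
    · intro m
      simp [AlgHom.mul_apply, monomialValue, AddMonoidAlgebra.smul_single,
        Finset.prod_mul_distrib, mul_zpow, mul_comm]
    · exact Subsingleton.elim _ _

/-- The diagonal entries of the elements of a group of diagonal matrices. -/
def diagonalEntries {k : Type u} [Field k] {n : ℕ} (G : Subgroup (GL (Fin n) k))
    (hG : ∀ g ∈ G, (g : Matrix (Fin n) (Fin n) k).IsDiag) : G →* (Fin n → kˣ) :=
  MonoidHom.pi fun i => MonoidHom.toHomUnits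
    { toFun g := (g : GL (Fin n) k) i i
      map_one' := by simp
      map_mul' g h := by
        have hg := hG g g.2
        rw [Subgroup.coe_mul, Units.val_mul, Matrix.mul_apply, Finset.sum_eq_single i]
        · intro j _ hj
          rw [hg hj.symm, zero_mul]
        · simp }

/-- The quotient `kⁿ / G` by a finite group `G ⊆ GLₙ(k)`. -/
def affineQuotient {k : Type u} [Field k] {n : ℕ} (G : Subgroup (GL (Fin n) k)) [Finite G] :
    Var k :=
  quotientVar ((linearAction k n).comp G.subtype)

/-- The quotient `(k^*)ⁿ / G` by a finite group `G ⊆ GLₙ(k)` of diagonal matrices. -/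
def torusQuotient {k : Type u} [Field k] {n : ℕ} (G : Subgroup (GL (Fin n) k)) [Finite G]
    (hG : ∀ g ∈ G, (g : Matrix (Fin n) (Fin n) k).IsDiag) : Var k :=
  quotientVar ((translationAction k n).comp (diagonalEntries G hG))

end MotivicClass

end

open AlgebraicGeometry CategoryTheory MonoidalCategory TensorProduct

universe u

/-! A group of diagonal matrices scales every monomial, so its invariant functions are spanned by
the monomials whose exponents lie in the lattice M of characters trivial on G. Since |G| kills G, M
contains a positive multiple of each unit vector and has rank n. On the torus the invariant ring is
thus the group algebra of M ≅ ℤⁿ, which gives (1) with `cls_torus`.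

On affine space the invariant ring is the algebra of M ∩ ℕⁿ, the coordinate ring of a simplicial
toric variety. `cls_latticeCone` computes its class by induction, for any lattice M and any set S of
coordinates required to be nonnegative. Inverting a monomial x_i^e with i ∈ S removes the constraint
at i; the closed complement, with its reduced structure, is the toric variety of the face m_i = 0,
whose lattice has rank one less. If M has rank |S| + s, the class is 𝕃^|S| (𝕃 - 1)^s: the induction
starts from tori and rests on (𝕃 - 1) + 1 = 𝕃. For S everything and s = 0 this is 𝕃ⁿ.

A finite abelian group is diagonalizable over ℂ (`exists_conj_isDiag`), and conjugate groups have
isomorphic invariant rings, so (2) reduces to the diagonal case. -/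

namespace MotivicClass

/-! ### Classes of affine varieties: isomorphisms, products, scissors -/

section SpecVar

variable {k : Type u} [Field k] {A B C : Type u} [CommRing A] [CommRing B] [CommRing C]
  [Algebra k A] [Algebra k B] [Algebra k C] [Algebra.FiniteType k A] [Algebra.FiniteType k B]
  [Algebra.FiniteType k C]

/-- The morphism of affine varieties induced by a homomorphism of `k`-algebras. -/
noncomputable def specVarMap (f : A →ₐ[k] B) : specVar k B ⟶ specVar k A :=
  ObjectProperty.homMk (Over.homMk (Spec.map (CommRingCat.ofHom f.toRingHom)) (by
    change Spec.map _ ≫ Spec.map _ = Spec.map _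
    rw [← Spec.map_comp, ← CommRingCat.ofHom_comp]
    congr 2
    exact f.comp_algebraMap))

lemma specVarMap_comp (f : A →ₐ[k] B) (g : B →ₐ[k] C) :
    specVarMap g ≫ specVarMap f = specVarMap (g.comp f) := by
  apply ObjectProperty.hom_ext
  apply Over.OverMorphism.ext
  change Spec.map _ ≫ Spec.map _ = Spec.map _
  rw [← Spec.map_comp, ← CommRingCat.ofHom_comp]
  rfl

lemma specVarMap_id : specVarMap (AlgHom.id k A) = 𝟙 _ := by
  apply ObjectProperty.hom_ext
  apply Over.OverMorphism.ext
  exact Spec.map_id _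

/-- Isomorphic algebras have isomorphic spectra. -/
noncomputable def specVarIso (e : A ≃ₐ[k] B) : specVar k A ≅ specVar k B where
  hom := specVarMap e.symm.toAlgHom
  inv := specVarMap e.toAlgHom
  hom_inv_id := by
    rw [specVarMap_comp, ← specVarMap_id]
    congr 1
    ext
    simp
  inv_hom_id := by
    rw [specVarMap_comp, ← specVarMap_id]
    congr 1
    ext
    simp

lemma K0.cls_eq_of_iso {X Y : Var k} (e : X ≅ Y) : K0.cls X = K0.cls Y := by
  have : freeClass X = freeClass Y :=
    congrArg FreeAbelianGroup.of (toSkeleton_eq_toSkeleton_iff.mpr ⟨e⟩)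
  rw [K0.cls, K0.cls, this]

lemma K0.cls_specVar_congr (e : A ≃ₐ[k] B) : K0.cls (specVar k A) = K0.cls (specVar k B) :=
  K0.cls_eq_of_iso (specVarIso e)

lemma K0.cls_tensor (X Y : Var k) : K0.cls (X ⊗ Y) = K0.cls X * K0.cls Y := by
  rw [K0.cls, freeClass_tensor, map_mul]; rfl

lemma K0.cls_unit : K0.cls (𝟙_ (Var k)) = 1 := by
  have : freeClass (𝟙_ (Var k)) = 1 := rfl
  rw [K0.cls, this, map_one]

lemma K0.cls_specVar_self : K0.cls (specVar k k) = 1 := by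
  rw [← K0.cls_unit]
  refine K0.cls_eq_of_iso ((isVariety k).isoMk (Over.isoMk (Iso.refl _) ?_))
  change 𝟙 _ ≫ 𝟙 _ = Spec.map (𝟙 _)
  rw [Spec.map_id, Category.comp_id]

lemma K0.cls_specVar_tensor [Algebra.FiniteType k (A ⊗[k] B)] :
    K0.cls (specVar k (A ⊗[k] B)) = K0.cls (specVar k A) * K0.cls (specVar k B) := by
  rw [← K0.cls_tensor]
  refine K0.cls_eq_of_iso ((isVariety k).isoMk (Over.isoMk (pullbackSpecIso k A B).symm ?_))
  change (pullbackSpecIso k A B).inv ≫ (Limits.pullback.fst _ _ ≫ _) = _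
  refine (pullbackSpecIso_inv_fst_assoc k A B _).trans ?_
  change Spec.map _ ≫ Spec.map _ = Spec.map _
  rw [← Spec.map_comp, ← CommRingCat.ofHom_comp]

/-- The scissors relation for a principal open subset `D(a)` of an affine variety. -/
lemma K0.cls_specVar_eq_add (a : A) (j : A →ₐ[k] B) (i : A →ₐ[k] C)
    (hj : @IsLocalization.Away A _ a B _ j.toRingHom.toAlgebra)
    (hi : Function.Surjective i) (ha : i a = 0) (hker : ∀ x, i x = 0 → ∃ n : ℕ, a ∣ x ^ n)
    [IsReduced C] :
    K0.cls (specVar k A) = K0.cls (specVar k B) + K0.cls (specVar k C) := by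
  have h : Rel (freeClass (specVar k A) - freeClass (specVar k B) - freeClass (specVar k C)) := by
    refine Rel.scissors (specVarMap j) (specVarMap i) ?_ ?_ ?_ ?_
    · let _ := j.toRingHom.toAlgebra
      exact IsOpenImmersion.of_isLocalization a
    · exact IsClosedImmersion.spec_of_surjective _ hi
    · change IsReduced (Spec (CommRingCat.of C))
      infer_instance
    · let _ := j.toRingHom.toAlgebra
      change Set.range (PrimeSpectrum.comap i.toRingHom) =
        (Set.range (PrimeSpectrum.comap (algebraMap A B)))ᶜ
      rw [PrimeSpectrum.localization_away_comap_range B a,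
        range_comap_of_surjective _ _ hi]
      ext p
      simp only [PrimeSpectrum.mem_zeroLocus, Set.mem_compl_iff, SetLike.mem_coe,
        PrimeSpectrum.mem_basicOpen, not_not]
      -- By `ha` and `hker`, (a) ⊆ ker i ⊆ √(a), so the two ideals have the same zero locus.
      refine ⟨fun hp => hp ha, fun hp x hx => ?_⟩
      obtain ⟨n, y, hy⟩ := hker x hx
      exact p.isPrime.mem_of_pow_mem n (hy ▸ Ideal.mul_mem_right _ _ hp)
  have : Ideal.Quotient.mk (relIdeal k)
      (freeClass (specVar k A) - freeClass (specVar k B) - freeClass (specVar k C)) = 0 :=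
    Ideal.Quotient.eq_zero_iff_mem.mpr (AddSubgroup.subset_closure h)
  rw [sub_sub, map_sub, map_add, sub_eq_zero] at this
  exact this

end SpecVar

/-! ### Monoid algebras: localization at a monomial and restriction to a face -/

section MonoidAlgebra

variable {k : Type u} [Field k] {E : Type} [AddCommGroup E]

/-- The inclusion of monoid algebras induced by an inclusion of submonoids. -/
noncomputable def monoidAlgebraInclusion (k : Type u) [Field k] {P Q : AddSubmonoid E}
    (h : P ≤ Q) : AddMonoidAlgebra k P →ₐ[k] AddMonoidAlgebra k Q :=
  AddMonoidAlgebra.mapDomainAlgHom k k (AddSubmonoid.inclusion h)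

lemma monoidAlgebraInclusion_single {P Q : AddSubmonoid E} (h : P ≤ Q) (p : P) (c : k) :
    monoidAlgebraInclusion k h (AddMonoidAlgebra.single p c) =
      AddMonoidAlgebra.single (AddSubmonoid.inclusion h p) c :=
  AddMonoidAlgebra.mapDomain_single

lemma monoidAlgebraInclusion_injective {P Q : AddSubmonoid E} (h : P ≤ Q) :
    Function.Injective (monoidAlgebraInclusion k h) :=
  AddMonoidAlgebra.mapDomain_injective (AddSubmonoid.inclusion_injective h)

/-- Inverting a monomial in a monoid algebra. -/
lemma isLocalizationAway_monoidAlgebraInclusion {P Q : AddSubmonoid E} (h : P ≤ Q) (v : P)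
    (hv : -(v : E) ∈ Q) (hQ : ∀ q ∈ Q, ∃ n : ℕ, q + n • (v : E) ∈ P) :
    @IsLocalization.Away _ _ (AddMonoidAlgebra.single v (1 : k)) _ _
      (monoidAlgebraInclusion k h).toRingHom.toAlgebra := by
  let _ := (monoidAlgebraInclusion k h).toRingHom.toAlgebra
  have hpow (n : ℕ) : (monoidAlgebraInclusion k h (AddMonoidAlgebra.single v 1)) ^ n =
      AddMonoidAlgebra.single (n • AddSubmonoid.inclusion h v) 1 := by
    rw [monoidAlgebraInclusion_single, AddMonoidAlgebra.single_pow, one_pow]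
  refine IsLocalization.Away.mk _ ?_ ?_ ?_
  · refine IsUnit.of_mul_eq_one (AddMonoidAlgebra.single ⟨_, hv⟩ 1) ?_
    change monoidAlgebraInclusion k h _ * _ = 1
    rw [monoidAlgebraInclusion_single, AddMonoidAlgebra.single_mul_single, mul_one,
      AddMonoidAlgebra.one_def]
    congr 1
    ext
    simp
  · intro s
    change ∃ n a, s * (monoidAlgebraInclusion k h _) ^ n = monoidAlgebraInclusion k h a
    induction s using AddMonoidAlgebra.induction_linear with
    | zero => exact ⟨0, 0, by simp⟩
    | add x y hx hy =>
      obtain ⟨n, a, ha⟩ := hx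
      obtain ⟨m, b, hb⟩ := hy
      refine ⟨n + m, a * AddMonoidAlgebra.single v 1 ^ m + b * AddMonoidAlgebra.single v 1 ^ n, ?_⟩
      rw [map_add, map_mul, map_mul, ← ha, ← hb, map_pow, map_pow]
      ring
    | single q c =>
      obtain ⟨n, hn⟩ := hQ q q.2
      refine ⟨n, AddMonoidAlgebra.single ⟨_, hn⟩ c, ?_⟩
      rw [hpow, monoidAlgebraInclusion_single, AddMonoidAlgebra.single_mul_single, mul_one]
      congr 1
  · intro a b hab
    exact ⟨0, by rw [monoidAlgebraInclusion_injective h hab]⟩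

open Classical in
/-- The restriction of functions to the closed subset cut out by the monomials outside a face. -/
noncomputable def faceRestriction (k : Type u) [Field k] {P F : AddSubmonoid E}
    (hF : ∀ p ∈ P, ∀ q ∈ P, p + q ∈ F ↔ p ∈ F ∧ q ∈ F) :
    AddMonoidAlgebra k P →ₐ[k] AddMonoidAlgebra k F :=
  AddMonoidAlgebra.lift k _ P
    { toFun p := if h : (p.toAdd : E) ∈ F then AddMonoidAlgebra.single ⟨_, h⟩ 1 else 0
      map_one' := by
        rw [dif_pos (by simp)]
        rfl
      map_mul' p q := by
        -- The face condition makes discarding the monomials outside F multiplicative: a product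
        -- survives exactly when both factors do.
        have : ((p * q).toAdd : E) ∈ F ↔ (p.toAdd : E) ∈ F ∧ (q.toAdd : E) ∈ F :=
          hF p.toAdd p.toAdd.2 q.toAdd q.toAdd.2
        by_cases hp : (p.toAdd : E) ∈ F
        · by_cases hq : (q.toAdd : E) ∈ F
          · rw [dif_pos hp, dif_pos hq, dif_pos (this.mpr ⟨hp, hq⟩),
              AddMonoidAlgebra.single_mul_single, mul_one]
            rfl
          · rw [dif_neg hq, mul_zero, dif_neg fun h => hq (this.mp h).2]
        · rw [dif_neg hp, zero_mul, dif_neg fun h => hp (this.mp h).1] }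

open Classical in
lemma faceRestriction_single {P F : AddSubmonoid E}
    (hF : ∀ p ∈ P, ∀ q ∈ P, p + q ∈ F ↔ p ∈ F ∧ q ∈ F) (p : P) (c : k) :
    faceRestriction k hF (AddMonoidAlgebra.single p c) =
      if h : (p : E) ∈ F then AddMonoidAlgebra.single ⟨p, h⟩ c else 0 := by
  rw [faceRestriction, AddMonoidAlgebra.lift_single]
  by_cases h : (p : E) ∈ F
  · simp [h]
  · simp [h]

/-- The inclusion of the algebra of F is a section. -/
lemma faceRestriction_surjective {P F : AddSubmonoid E} (hFP : F ≤ P)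
    (hF : ∀ p ∈ P, ∀ q ∈ P, p + q ∈ F ↔ p ∈ F ∧ q ∈ F) :
    Function.Surjective (faceRestriction k hF) := by
  intro y
  refine ⟨monoidAlgebraInclusion k hFP y, ?_⟩
  induction y using AddMonoidAlgebra.induction_linear with
  | zero => simp
  | add x y hx hy => rw [map_add, map_add, hx, hy]
  | single q c =>
    rw [monoidAlgebraInclusion_single, faceRestriction_single]
    exact dif_pos q.2

lemma coeff_faceRestriction {P F : AddSubmonoid E}
    (hF : ∀ p ∈ P, ∀ q ∈ P, p + q ∈ F ↔ p ∈ F ∧ q ∈ F) (x : AddMonoidAlgebra k P) (p : P)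
    (hp : (p : E) ∈ F) : (faceRestriction k hF x).coeff ⟨p, hp⟩ = x.coeff p := by
  classical
  induction x using AddMonoidAlgebra.induction_linear with
  | zero => simp
  | add x y hx hy => simp [hx, hy]
  | single q c =>
    rw [faceRestriction_single]
    by_cases h : (q : E) ∈ F
    · rw [dif_pos h]
      rw [AddMonoidAlgebra.coeff_single, AddMonoidAlgebra.coeff_single, Finsupp.single_apply,
        Finsupp.single_apply]
      congr 1
      rw [Subtype.ext_iff, Subtype.ext_iff]
    · rw [dif_neg h]
      have : q ≠ p := fun e => h (e ▸ hp)
      simp [this]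

/-- An element of the kernel is supported outside F, and there each monomial has a power divisible
by x^v. As the radical of (x^v) is an ideal, it contains their sum. -/
lemma exists_dvd_pow_of_faceRestriction_eq_zero {P F : AddSubmonoid E}
    (hF : ∀ p ∈ P, ∀ q ∈ P, p + q ∈ F ↔ p ∈ F ∧ q ∈ F) (v : P)
    (hv : ∀ p ∈ P, p ∉ F → ∃ n : ℕ, n • p - v ∈ P) (x : AddMonoidAlgebra k P)
    (hx : faceRestriction k hF x = 0) :
    ∃ n : ℕ, AddMonoidAlgebra.single v (1 : k) ∣ x ^ n := by
  suffices x ∈ (Ideal.span {AddMonoidAlgebra.single v (1 : k)}).radical by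
    obtain ⟨n, hn⟩ := this
    exact ⟨n, Ideal.mem_span_singleton.mp hn⟩
  rw [← AddMonoidAlgebra.sum_coeff_single x]
  refine Ideal.sum_mem _ fun p hp => ?_
  have hpF : (p : E) ∉ F := by
    intro h
    rw [Finsupp.mem_support_iff, ← coeff_faceRestriction hF x p h, hx] at hp
    exact hp rfl
  obtain ⟨n, hn⟩ := hv p p.2 hpF
  refine ⟨n, Ideal.mem_span_singleton.mpr ⟨AddMonoidAlgebra.single ⟨_, hn⟩ (x.coeff p ^ n), ?_⟩⟩
  rw [AddMonoidAlgebra.single_pow, AddMonoidAlgebra.single_mul_single, one_mul]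
  congr 1
  ext
  simp

/-- The algebra embeds in that of E, which has no zero divisors because E has unique sums. The
scissors relation needs a reduced closed piece. -/
instance isReduced_monoidAlgebra [UniqueSums E] (F : AddSubmonoid E) :
    _root_.IsReduced (AddMonoidAlgebra k F) := by
  have hinj : Function.Injective (AddMonoidAlgebra.mapDomainAlgHom k k F.subtype) :=
    AddMonoidAlgebra.mapDomain_injective Subtype.val_injective
  exact isReduced_of_injective _ hinj

/-- Finite generation passes from P to both the closed and the open piece, so the induction on cones
does not need Gordan's lemma. -/
lemma finiteType_monoidAlgebra_of_face {P F : AddSubmonoid E} (hFP : F ≤ P)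
    (hF : ∀ p ∈ P, ∀ q ∈ P, p + q ∈ F ↔ p ∈ F ∧ q ∈ F)
    [Algebra.FiniteType k (AddMonoidAlgebra k P)] :
    Algebra.FiniteType k (AddMonoidAlgebra k F) :=
  Algebra.FiniteType.of_surjective (faceRestriction k hF) (faceRestriction_surjective hFP hF)

lemma finiteType_monoidAlgebra_of_isLocalization {P Q : AddSubmonoid E} (h : P ≤ Q) (v : P)
    (hv : -(v : E) ∈ Q) (hQ : ∀ q ∈ Q, ∃ n : ℕ, q + n • (v : E) ∈ P)
    [Algebra.FiniteType k (AddMonoidAlgebra k P)] :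
    Algebra.FiniteType k (AddMonoidAlgebra k Q) := by
  let _ := (monoidAlgebraInclusion k h).toRingHom.toAlgebra
  have := isLocalizationAway_monoidAlgebraInclusion (k := k) h v hv hQ
  have : IsScalarTower k (AddMonoidAlgebra k P) (AddMonoidAlgebra k Q) :=
    IsScalarTower.of_algebraMap_eq' (monoidAlgebraInclusion k h).comp_algebraMap.symm
  have : Algebra.FiniteType (AddMonoidAlgebra k P) (AddMonoidAlgebra k Q) :=
    IsLocalization.finiteType_of_monoid_fg
      (Submonoid.powers (AddMonoidAlgebra.single v (1 : k))) _
  exact Algebra.FiniteType.trans ‹_› this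

/-- The affine toric variety of a monoid `P` is the union of the open subset where a monomial
`x ^ v` is invertible and the closed subset of a complementary face `F`. -/
lemma cls_monoidAlgebra_eq_add [UniqueSums E] {P Q F : AddSubmonoid E} (hPQ : P ≤ Q)
    (hFP : F ≤ P) (hF : ∀ p ∈ P, ∀ q ∈ P, p + q ∈ F ↔ p ∈ F ∧ q ∈ F) (v : P)
    (hvF : (v : E) ∉ F) (hv : ∀ p ∈ P, p ∉ F → ∃ n : ℕ, n • p - v ∈ P)
    (hvQ : -(v : E) ∈ Q) (hQ : ∀ q ∈ Q, ∃ n : ℕ, q + n • (v : E) ∈ P)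
    [Algebra.FiniteType k (AddMonoidAlgebra k P)] [Algebra.FiniteType k (AddMonoidAlgebra k Q)]
    [Algebra.FiniteType k (AddMonoidAlgebra k F)] :
    K0.cls (specVar k (AddMonoidAlgebra k P)) =
      K0.cls (specVar k (AddMonoidAlgebra k Q)) + K0.cls (specVar k (AddMonoidAlgebra k F)) :=
  K0.cls_specVar_eq_add (AddMonoidAlgebra.single v 1) (monoidAlgebraInclusion k hPQ)
    (faceRestriction k hF) (isLocalizationAway_monoidAlgebraInclusion hPQ v hvQ hQ)
    (faceRestriction_surjective hFP hF) (by rw [faceRestriction_single, dif_neg hvF])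
    (exists_dvd_pow_of_faceRestriction_eq_zero hF v hv)

end MonoidAlgebra

/-! ### The class of a torus -/

section Torus

/-- This is the toric decomposition of the affine line, with P = ℕ, Q = ℤ and F = 0. -/
lemma K0.cls_specVar_addMonoidAlgebra_int (k : Type u) [Field k] :
    K0.cls (specVar k (AddMonoidAlgebra k ℤ)) = lefschetz k - 1 := by
  let P : AddSubmonoid ℤ := AddSubmonoid.nonneg ℤ
  have eP : AddMonoidAlgebra k P ≃ₐ[k] MvPolynomial (Fin 1) k :=
    AddMonoidAlgebra.domCongr k k
      { toFun p := Finsupp.single 0 p.1.toNat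
        invFun m := ⟨m 0, Int.natCast_nonneg _⟩
        left_inv p := by
          have : 0 ≤ p.1 := p.2
          ext
          simpa using this
        right_inv m := by
          refine Finsupp.ext fun i => ?_
          rw [Subsingleton.elim i 0]
          simp
        map_add' p q := by
          have hp : 0 ≤ p.1 := p.2
          have hq : 0 ≤ q.1 := q.2
          rw [← Finsupp.single_add, AddSubmonoid.coe_add, Int.toNat_add hp hq] }
  have eQ : AddMonoidAlgebra k (⊤ : AddSubmonoid ℤ) ≃ₐ[k] AddMonoidAlgebra k ℤ :=
    AddMonoidAlgebra.domCongr k k AddSubmonoid.topEquiv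
  have : Subsingleton (⊥ : AddSubmonoid ℤ) := ⟨fun a b => Subtype.ext (a.2.trans b.2.symm)⟩
  have eF : AddMonoidAlgebra k (⊥ : AddSubmonoid ℤ) ≃ₐ[k] k :=
    AddMonoidAlgebra.uniqueAlgEquiv k (⊥ : AddSubmonoid ℤ)
  have := Algebra.FiniteType.equiv inferInstance eP.symm
  have := Algebra.FiniteType.equiv inferInstance eQ.symm
  have := Algebra.FiniteType.equiv inferInstance eF.symm
  have h := cls_monoidAlgebra_eq_add (k := k) (P := P) (Q := ⊤) (F := ⊥) le_top bot_le
    (fun p (hp : 0 ≤ p) q (hq : 0 ≤ q) => by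
      simp only [AddSubmonoid.mem_bot]
      omega)
    ⟨1, Int.one_nonneg⟩ (by simp)
    (fun p (hp : 0 ≤ p) hp' => ⟨1, by
      rw [AddSubmonoid.mem_bot] at hp'
      change 0 ≤ 1 • p - 1
      rw [one_smul]
      omega⟩)
    (AddSubmonoid.mem_top _) (fun q _ => ⟨q.natAbs, by
      change 0 ≤ q + q.natAbs • (1 : ℤ)
      rw [nsmul_eq_mul, mul_one]
      omega⟩)
  rw [K0.cls_specVar_congr eP, K0.cls_specVar_congr eQ, K0.cls_specVar_congr eF,
    K0.cls_specVar_self] at h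
  rw [eq_sub_iff_add_eq, ← h]
  rfl

/-- The coordinate ring of a torus is a tensor power of that of `𝔾_m`. -/
noncomputable def laurentSuccEquiv (k : Type u) [Field k] (n : ℕ) :
    AddMonoidAlgebra k ℤ ⊗[k] Laurent k n ≃ₐ[k] Laurent k (n + 1) :=
  let e : AddMonoidAlgebra k ℤ ⊗[k] Laurent k n ≃ₐ[AddMonoidAlgebra k ℤ]
      AddMonoidAlgebra (AddMonoidAlgebra k ℤ) (Fin n → ℤ) :=
    AddMonoidAlgebra.scalarTensorEquiv k (AddMonoidAlgebra k ℤ)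
  let e' : AddMonoidAlgebra k ((Fin n → ℤ) × ℤ) ≃ₐ[k]
      AddMonoidAlgebra (AddMonoidAlgebra k ℤ) (Fin n → ℤ) :=
    AddMonoidAlgebra.curryAlgEquiv k
  let e'' : (Fin n → ℤ) × ℤ ≃+ (Fin (n + 1) → ℤ) :=
    AddEquiv.prodComm.trans (Fin.consLinearEquiv ℤ fun _ => ℤ).toAddEquiv
  (e.restrictScalars k).trans (e'.symm.trans (AddMonoidAlgebra.domCongr k k e''))

lemma K0.cls_torus (k : Type u) [Field k] (n : ℕ) :
    K0.cls (torus k n) = (lefschetz k - 1) ^ n := by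
  induction n with
  | zero =>
    rw [pow_zero, ← K0.cls_specVar_self]
    exact K0.cls_specVar_congr (AddMonoidAlgebra.uniqueAlgEquiv k _)
  | succ n ih =>
    have := Algebra.FiniteType.equiv inferInstance (laurentSuccEquiv k n).symm
    rw [torus, ← K0.cls_specVar_congr (laurentSuccEquiv k n), K0.cls_specVar_tensor,
      K0.cls_specVar_addMonoidAlgebra_int, pow_succ', ← ih, torus]

end Torus

/-! ### Simplicial cones in a lattice -/

section Cone

variable {ι : Type}

/-- The elements of a lattice `M ⊆ ℤ^ι` whose coordinates in `S` are nonnegative. -/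
def latticeCone (M : Submodule ℤ (ι → ℤ)) (S : Finset ι) : AddSubmonoid (ι → ℤ) where
  carrier := {m | m ∈ M ∧ ∀ i ∈ S, 0 ≤ m i}
  zero_mem' := ⟨zero_mem M, fun _ _ => le_rfl⟩
  add_mem' ha hb := ⟨add_mem ha.1 hb.1, fun i hi => add_nonneg (ha.2 i hi) (hb.2 i hi)⟩

/-- The sublattice of elements with vanishing `i`-th coordinate. -/
def latticeFace (M : Submodule ℤ (ι → ℤ)) (i : ι) : Submodule ℤ (ι → ℤ) :=
  M ⊓ LinearMap.ker (LinearMap.proj (R := ℤ) (φ := fun _ : ι => ℤ) i)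

/-- The algebra of a lattice of rank `n` is the coordinate ring of a torus. -/
noncomputable def latticeConeEmptyEquiv (k : Type u) [Field k] [Finite ι]
    (M : Submodule ℤ (ι → ℤ)) {n : ℕ} (hn : Module.finrank ℤ M = n) :
    AddMonoidAlgebra k (latticeCone M ∅) ≃ₐ[k] Laurent k n :=
  AddMonoidAlgebra.domCongr k k
    (AddEquiv.trans (N := M)
      { toFun m := ⟨m, m.2.1⟩
        invFun m := ⟨m, m.2, fun _ h => absurd h (Finset.notMem_empty _)⟩
        left_inv _ := rfl
        right_inv _ := rfl
        map_add' _ _ := rfl }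
      -- As a submodule of a finite free ℤ-module, M is free.
      (Module.finBasisOfFinrankEq ℤ M hn).equivFun.toAddEquiv)

variable [DecidableEq ι] [Finite ι]

/-- Rank-nullity for the i-th coordinate on M, whose image is a nonzero ideal of ℤ because it
contains e. -/
lemma finrank_latticeFace_add_one (M : Submodule ℤ (ι → ℤ)) (i : ι) {e : ℤ} (he : 0 < e)
    (hM : Pi.single i e ∈ M) :
    Module.finrank ℤ (latticeFace M i) + 1 = Module.finrank ℤ M := by
  let f : M →ₗ[ℤ] ℤ := (LinearMap.proj (R := ℤ) (φ := fun _ : ι => ℤ) i).comp M.subtype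
  have h1 : Module.finrank ℤ (LinearMap.ker f) = Module.finrank ℤ (latticeFace M i) := by
    have : latticeFace M i = (LinearMap.ker f).map M.subtype := by
      rw [LinearMap.ker_comp, Submodule.map_comap_subtype]
      rfl
    rw [this]
    exact (LinearEquiv.finrank_eq (Submodule.equivMapOfInjective _ M.injective_subtype _))
  have h2 : Module.finrank ℤ (LinearMap.range f) = 1 := by
    refine le_antisymm ((Submodule.finrank_le _).trans (Module.finrank_self ℤ).le) ?_
    refine Module.finrank_pos_iff_exists_ne_zero.mpr ⟨⟨e, ⟨⟨_, hM⟩, ?_⟩⟩, ?_⟩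
    · exact Pi.single_eq_same (M := fun _ => ℤ) i e
    · exact fun h => he.ne' (congrArg Subtype.val h)
  rw [← Submodule.finrank_quotient_add_finrank (LinearMap.ker f),
    f.quotKerEquivRange.finrank_eq, h1, h2, add_comm]

/-- The class of the affine toric variety of a simplicial cone. -/
theorem cls_latticeCone (k : Type u) [Field k] (S : Finset ι) (M : Submodule ℤ (ι → ℤ)) (s : ℕ)
    (hM : ∀ i ∈ S, ∃ e : ℤ, 0 < e ∧ Pi.single i e ∈ M) (hs : Module.finrank ℤ M = S.card + s)
    [Algebra.FiniteType k (AddMonoidAlgebra k (latticeCone M S))] :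
    K0.cls (specVar k (AddMonoidAlgebra k (latticeCone M S))) =
      lefschetz k ^ S.card * (lefschetz k - 1) ^ s := by
  -- The open piece keeps M and raises s by one; the closed piece replaces M by a face and keeps s.
  induction S using Finset.induction_on generalizing M s with
  | empty =>
    rw [Finset.card_empty, zero_add] at hs
    rw [K0.cls_specVar_congr (latticeConeEmptyEquiv k M hs), Finset.card_empty, pow_zero, one_mul]
    exact K0.cls_torus k s
  | insert i S hi ih =>
    obtain ⟨e, he, hei⟩ := hM i (Finset.mem_insert_self i S)
    have hne {j : ι} (hj : j ∈ S) : j ≠ i := fun h => hi (h ▸ hj)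
    rw [Finset.card_insert_of_notMem hi] at hs ⊢
    have hPQ : latticeCone M (insert i S) ≤ latticeCone M S := fun m hm =>
      ⟨hm.1, fun j hj => hm.2 j (Finset.mem_insert_of_mem hj)⟩
    have hFP : latticeCone (latticeFace M i) S ≤ latticeCone M (insert i S) := fun m hm =>
      ⟨hm.1.1, Finset.forall_mem_insert _ _ _ |>.mpr ⟨hm.1.2.ge, hm.2⟩⟩
    have hF : ∀ p ∈ latticeCone M (insert i S), ∀ q ∈ latticeCone M (insert i S),
        p + q ∈ latticeCone (latticeFace M i) S ↔
          p ∈ latticeCone (latticeFace M i) S ∧ q ∈ latticeCone (latticeFace M i) S := by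
      intro p hp q hq
      refine ⟨fun h => ?_, fun h => add_mem h.1 h.2⟩
      have h0 : p i + q i = 0 := h.1.2
      have hpi := hp.2 i (Finset.mem_insert_self i S)
      have hqi := hq.2 i (Finset.mem_insert_self i S)
      exact ⟨⟨⟨hp.1, show p i = 0 by omega⟩, (hPQ hp).2⟩,
        ⟨⟨hq.1, show q i = 0 by omega⟩, (hPQ hq).2⟩⟩
    have hv : Pi.single i e ∈ latticeCone M (insert i S) :=
      ⟨hei, fun j _ => (Pi.single_nonneg.mpr he.le : (0 : ι → ℤ) ≤ Pi.single i e) j⟩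
    have hvF : Pi.single i e ∉ latticeCone (latticeFace M i) S := fun h =>
      he.ne' ((Pi.single_eq_same (M := fun _ => ℤ) i e).symm.trans h.1.2)
    have hvP : ∀ p ∈ latticeCone M (insert i S), p ∉ latticeCone (latticeFace M i) S →
        ∃ n : ℕ, n • p - Pi.single i e ∈ latticeCone M (insert i S) := by
      intro p hp hpF
      have hpi := hp.2 i (Finset.mem_insert_self i S)
      have hpi' : p i ≠ 0 := fun h => hpF ⟨⟨hp.1, h⟩, (hPQ hp).2⟩
      -- Here p i ≥ 1, so e copies of p have i-th coordinate at least e.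
      refine ⟨e.toNat, sub_mem (nsmul_mem hp.1 _) hei, Finset.forall_mem_insert _ _ _ |>.mpr
        ⟨?_, fun j hj => ?_⟩⟩
      · rw [Pi.sub_apply, Pi.smul_apply, Pi.single_eq_same, nsmul_eq_mul, Int.toNat_of_nonneg he.le]
        nlinarith [show 1 ≤ p i by omega]
      · rw [Pi.sub_apply, Pi.smul_apply, Pi.single_eq_of_ne (hne hj), sub_zero]
        exact nsmul_nonneg ((hPQ hp).2 j hj) _
    have hvQ : -Pi.single i e ∈ latticeCone M S :=
      ⟨neg_mem hei, fun j hj => by rw [Pi.neg_apply, Pi.single_eq_of_ne (hne hj), neg_zero]⟩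
    have hQ : ∀ q ∈ latticeCone M S, ∃ n : ℕ,
        q + n • Pi.single i e ∈ latticeCone M (insert i S) := by
      intro q hq
      -- Since e ≥ 1, adding |q i| copies of the vector makes the i-th coordinate nonnegative.
      refine ⟨(q i).natAbs, add_mem hq.1 (nsmul_mem hei _), Finset.forall_mem_insert _ _ _ |>.mpr
        ⟨?_, fun j hj => ?_⟩⟩
      · rw [Pi.add_apply, Pi.smul_apply, Pi.single_eq_same, nsmul_eq_mul]
        have : -q i ≤ (q i).natAbs := by omega
        nlinarith [Int.natCast_nonneg (q i).natAbs]
      · rw [Pi.add_apply, Pi.smul_apply, Pi.single_eq_of_ne (hne hj), smul_zero, add_zero]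
        exact hq.2 j hj
    have := finiteType_monoidAlgebra_of_face (k := k) hFP hF
    have := finiteType_monoidAlgebra_of_isLocalization (k := k) hPQ ⟨_, hv⟩ hvQ hQ
    have hface := finrank_latticeFace_add_one M i he hei
    rw [cls_monoidAlgebra_eq_add hPQ hFP hF ⟨_, hv⟩ hvF hvP hvQ hQ,
      ih M (s + 1) (fun j hj => hM j (Finset.mem_insert_of_mem hj)) (by omega),
      ih (latticeFace M i) s (fun j hj => ?_) (by omega)]
    -- 𝕃^|S| (𝕃 - 1)^(s+1) + 𝕃^|S| (𝕃 - 1)^s = 𝕃^(|S|+1) (𝕃 - 1)^s.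
    · ring
    · obtain ⟨e', he', hej⟩ := hM j (Finset.mem_insert_of_mem hj)
      exact ⟨e', he', hej, Pi.single_eq_of_ne (M := fun _ => ℤ) (hne hj).symm e'⟩

/-- Nonzero multiples of the unit vectors are linearly independent in M, which gives the lower
bound. -/
lemma finrank_eq_card_of_forall_single_mem [Fintype ι] (M : Submodule ℤ (ι → ℤ))
    (hM : ∀ i, ∃ e : ℤ, 0 < e ∧ Pi.single i e ∈ M) :
    Module.finrank ℤ M = Fintype.card ι := by
  refine le_antisymm ((Submodule.finrank_le M).trans (Module.finrank_fintype_fun_eq_card ℤ).le) ?_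
  choose e he hM using hM
  refine LinearIndependent.fintype_card_le_finrank
    (b := fun i => (⟨Pi.single i (e i), hM i⟩ : M)) ?_
  refine LinearIndependent.of_comp M.subtype ?_
  rw [Fintype.linearIndependent_iff]
  intro g hg i
  have := congrFun hg i
  simp only [Function.comp_apply, Submodule.subtype_apply, Finset.sum_apply, Pi.smul_apply,
    Pi.zero_apply] at this
  rw [Finset.sum_eq_single i (fun j _ hj => by rw [Pi.single_eq_of_ne hj.symm, smul_zero])
    (by simp), Pi.single_eq_same, smul_eq_mul] at this
  exact (mul_eq_zero.mp this).resolve_right (he i).ne'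

end Cone

/-! ### Invariants of actions that scale monomials -/

section Invariants

variable {k : Type u} [Field k] {G : Type*} [Group G]

lemma coeff_of_forall_single {N : Type} [AddCommMonoid N] (f : AddMonoidAlgebra k N →ₐ[k]
    AddMonoidAlgebra k N) (χ : N → k)
    (hf : ∀ m c, f (AddMonoidAlgebra.single m c) = AddMonoidAlgebra.single m (χ m * c))
    (x : AddMonoidAlgebra k N) (m : N) : (f x).coeff m = χ m * x.coeff m := by
  classical
  induction x using AddMonoidAlgebra.induction_linear with
  | zero => simp
  | add x y hx hy => simp [hx, hy, mul_add]
  | single q c =>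
    rw [hf, AddMonoidAlgebra.coeff_single, AddMonoidAlgebra.coeff_single, Finsupp.single_apply,
      Finsupp.single_apply]
    by_cases h : q = m
    · rw [if_pos h, if_pos h, h]
    · rw [if_neg h, if_neg h, mul_zero]

/-- If a group acts on a monoid algebra by scaling the monomials, then the algebra of invariants
is spanned by the invariant monomials. -/
noncomputable def monomialInvariantsEquiv {N P : Type} [AddCommMonoid N] [AddCommMonoid P]
    (ρ : G →* (AddMonoidAlgebra k N →ₐ[k] AddMonoidAlgebra k N)) (χ : G → N → k)
    (hρ : ∀ g m c, ρ g (AddMonoidAlgebra.single m c) = AddMonoidAlgebra.single m (χ g m * c))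
    (φ : P →+ N) (hφ : Function.Injective φ)
    (hrange : ∀ m, m ∈ Set.range φ ↔ ∀ g, χ g m = 1) :
    AddMonoidAlgebra k P ≃ₐ[k] invariants ρ :=
  AlgEquiv.ofBijective
    ((AddMonoidAlgebra.mapDomainAlgHom k k φ).codRestrict (invariants ρ) fun x g => by
      induction x using AddMonoidAlgebra.induction_linear with
      | zero => rw [map_zero, map_zero]
      | add x y hx hy => rw [map_add, map_add, hx, hy]
      | single p c =>
        have : AddMonoidAlgebra.mapDomainAlgHom k k φ (AddMonoidAlgebra.single p c) =
          AddMonoidAlgebra.single (φ p) c := AddMonoidAlgebra.mapDomain_single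
        rw [this, hρ, (hrange (φ p)).mp ⟨p, rfl⟩ g, one_mul])
    ⟨fun x y hxy => AddMonoidAlgebra.mapDomain_injective hφ (congrArg Subtype.val hxy), by
      rintro ⟨x, hx⟩
      refine ⟨AddMonoidAlgebra.comapDomain φ hφ x, Subtype.ext ?_⟩
      -- Comparing coefficients in ρ g x = x forces χ g m = 1 for each m in the support of x, so x
      -- comes from P.
      refine AddMonoidAlgebra.mapDomain_comapDomain (fun m hm => (hrange m).mpr fun g => ?_) hφ
      have hm' : x.coeff m ≠ 0 := Finsupp.mem_support_iff.mp hm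
      refine mul_right_cancel₀ hm' ?_
      rw [one_mul, ← coeff_of_forall_single (ρ g) (χ g) (hρ g), hx g]⟩

/-- The lattice of characters of the torus which are trivial on a group of diagonal matrices. -/
def characterLattice {n : ℕ} (t : G →* (Fin n → kˣ)) : Submodule ℤ (Fin n → ℤ) :=
  AddSubgroup.toIntSubmodule
    { carrier := {m | ∀ g, monomialValue (t g) m = 1}
      zero_mem' := fun g => by simp [monomialValue]
      add_mem' := fun {a b} ha hb g => by
        have : monomialValue (t g) (a + b) = monomialValue (t g) a * monomialValue (t g) b := by
          simp [monomialValue, zpow_add, Finset.prod_mul_distrib]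
        rw [this, ha g, hb g, one_mul]
      neg_mem' := fun {a} ha g => by
        have : monomialValue (t g) (-a) = (monomialValue (t g) a)⁻¹ := by
          simp [monomialValue]
        rw [this, ha g, inv_one] }

lemma mem_characterLattice {n : ℕ} {t : G →* (Fin n → kˣ)} {m : Fin n → ℤ} :
    m ∈ characterLattice t ↔ ∀ g, monomialValue (t g) m = 1 := Iff.rfl

/-- The i-th entry of each t g has |G|-th power 1, so e = |G| works. -/
lemma exists_single_mem_characterLattice [Finite G] {n : ℕ} (t : G →* (Fin n → kˣ)) (i : Fin n) :
    ∃ e : ℤ, 0 < e ∧ Pi.single i e ∈ characterLattice t := by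
  refine ⟨Nat.card G, Int.natCast_pos.mpr Nat.card_pos, fun g => ?_⟩
  rw [monomialValue, Finset.prod_eq_single i]
  · rw [Pi.single_eq_same, zpow_natCast, ← Pi.pow_apply, ← map_pow, pow_card_eq_one', map_one,
      Pi.one_apply]
  · intro j _ hj
    rw [Pi.single_eq_of_ne hj, zpow_zero]
  · simp

lemma finrank_characterLattice [Finite G] {n : ℕ} (t : G →* (Fin n → kˣ)) :
    Module.finrank ℤ (characterLattice t) = n := by
  rw [finrank_eq_card_of_forall_single_mem _ (exists_single_mem_characterLattice t),
    Fintype.card_fin]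

lemma translationAction_single {n : ℕ} (t : Fin n → kˣ) (m : Fin n → ℤ) (c : k) :
    translationAction k n t (AddMonoidAlgebra.single m c) =
      AddMonoidAlgebra.single m ((monomialValue t⁻¹ m : k) * c) := by
  refine (AddMonoidAlgebra.lift_single _ _ _).trans ?_
  rw [MonoidHom.coe_mk, OneHom.coe_mk, AddMonoidAlgebra.smul_single, smul_eq_mul, mul_comm]
  rfl

/-- The coordinate ring of the quotient of a torus by a finite group of translations. -/
noncomputable def torusInvariantsEquiv [Finite G] {n : ℕ} (t : G →* (Fin n → kˣ)) :
    invariants ((translationAction k n).comp t) ≃ₐ[k] Laurent k n :=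
  (monomialInvariantsEquiv ((translationAction k n).comp t)
    (fun g m => (monomialValue (t g)⁻¹ m : k)) (fun g => translationAction_single (t g))
    (latticeCone (characterLattice t) ∅).subtype Subtype.val_injective (fun m => by
      -- Functions are acted on through inverses; as g runs over the whole group, this does not
      -- change the lattice.
      simp only [← map_inv, Units.val_eq_one]
      refine ⟨?_, fun h => ?_⟩
      · rintro ⟨m, rfl⟩ g
        exact m.2.1 g⁻¹
      · exact ⟨⟨m, fun g => by simpa using h g⁻¹, by simp⟩, rfl⟩)).symm.trans
    (latticeConeEmptyEquiv k _ (finrank_characterLattice t))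

/-- Nonnegative integer vectors in a lattice, as exponents of monomials. -/
noncomputable def latticeConeExponent {n : ℕ} (M : Submodule ℤ (Fin n → ℤ)) :
    latticeCone M Finset.univ →+ (Fin n →₀ ℕ) where
  -- Truncation by `toNat` loses nothing, because every coordinate is nonnegative.
  toFun m := Finsupp.equivFunOnFinite.symm fun i => (m.1 i).toNat
  map_zero' := by
    ext i
    simp
  map_add' a b := by
    ext i
    exact Int.toNat_add (a.2.2 i (Finset.mem_univ i)) (b.2.2 i (Finset.mem_univ i))

lemma latticeConeExponent_apply {n : ℕ} (M : Submodule ℤ (Fin n → ℤ))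
    (m : latticeCone M Finset.univ) (i : Fin n) : (latticeConeExponent M m i : ℤ) = m.1 i :=
  Int.toNat_of_nonneg (m.2.2 i (Finset.mem_univ i))

lemma latticeConeExponent_injective {n : ℕ} (M : Submodule ℤ (Fin n → ℤ)) :
    Function.Injective (latticeConeExponent M) := by
  intro a b h
  ext i
  rw [← latticeConeExponent_apply, ← latticeConeExponent_apply, h]

lemma mem_range_latticeConeExponent {n : ℕ} (M : Submodule ℤ (Fin n → ℤ)) (m : Fin n →₀ ℕ) :
    m ∈ Set.range (latticeConeExponent M) ↔ (fun i => (m i : ℤ)) ∈ M := by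
  constructor
  · rintro ⟨a, rfl⟩
    simp only [latticeConeExponent_apply]
    exact a.2.1
  · intro h
    refine ⟨⟨_, h, fun i _ => Int.natCast_nonneg _⟩, ?_⟩
    ext i
    exact Int.toNat_natCast _

/-- The scalars are the entries of g⁻¹, since g sends f to the function x ↦ f (g⁻¹ x). -/
lemma linearAction_single {n : ℕ} (g : GL (Fin n) k) (t : Fin n → kˣ)
    (hg : ((g⁻¹ : GL (Fin n) k) : Matrix (Fin n) (Fin n) k) = Matrix.diagonal fun i => (t i : k))
    (m : Fin n →₀ ℕ) (c : k) :
    linearAction k n g (MvPolynomial.monomial m c) =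
      MvPolynomial.monomial m ((monomialValue t fun i => (m i : ℤ) : k) * c) := by
  have hX (i : Fin n) : linearAction k n g (MvPolynomial.X i) =
      MvPolynomial.C (t i : k) * MvPolynomial.X i := by
    refine (MvPolynomial.aeval_X _ _).trans ?_
    rw [Finset.sum_eq_single i, hg, Matrix.diagonal_apply_eq]
    · intro j _ hj
      rw [hg, Matrix.diagonal_apply_ne _ hj.symm, map_zero, zero_mul]
    · simp
  rw [MvPolynomial.monomial_eq, Finsupp.prod_fintype _ _ (by simp), map_mul, map_prod,
    MvPolynomial.algHom_C, MvPolynomial.monomial_eq, Finsupp.prod_fintype _ _ (by simp)]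
  simp only [map_pow, hX, mul_pow, Finset.prod_mul_distrib, monomialValue, map_mul,
    MvPolynomial.algebraMap_eq, Units.coe_prod, zpow_natCast, Units.val_pow_eq_pow_val, map_prod]
  ring

end Invariants

/-! ### Quotients by diagonal groups -/

section Diagonal

variable {k : Type u} [Field k] {n : ℕ} (G : Subgroup (GL (Fin n) k))

lemma eq_diagonal_diagonalEntries
    (hG : ∀ g ∈ G, (g : Matrix (Fin n) (Fin n) k).IsDiag) (g : G) :
    ((g : GL (Fin n) k) : Matrix (Fin n) (Fin n) k) =
      Matrix.diagonal fun i => (diagonalEntries G hG g i : k) :=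
  ((hG g g.2).diagonal_diag).symm

/-- This views polynomials as a monoid algebra, the form required by `monomialInvariantsEquiv`. -/
lemma linearAction_subtype_single (hG : ∀ g ∈ G, (g : Matrix (Fin n) (Fin n) k).IsDiag) (g : G)
    (m : Fin n →₀ ℕ) (c : k) :
    (linearAction k n).comp G.subtype g (AddMonoidAlgebra.single m c) =
      AddMonoidAlgebra.single m
        ((monomialValue (diagonalEntries G hG g⁻¹) fun i => (m i : ℤ) : k) * c) := by
  have h := eq_diagonal_diagonalEntries G hG g⁻¹
  rw [Subgroup.coe_inv] at h
  exact linearAction_single (g : GL (Fin n) k) _ h m c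

/-- The coordinate ring of `kⁿ / G` for `G` diagonal is the algebra of the monoid of invariant
monomials. -/
noncomputable def affineInvariantsEquiv [Finite G]
    (hG : ∀ g ∈ G, (g : Matrix (Fin n) (Fin n) k).IsDiag) :
    AddMonoidAlgebra k (latticeCone (characterLattice (diagonalEntries G hG)) Finset.univ) ≃ₐ[k]
      invariants ((linearAction k n).comp G.subtype) :=
  monomialInvariantsEquiv ((linearAction k n).comp G.subtype)
    (fun g m => (monomialValue (diagonalEntries G hG g⁻¹) fun i => (m i : ℤ) : k))
    (linearAction_subtype_single G hG)
    (latticeConeExponent _) (latticeConeExponent_injective _) (fun m => by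
      rw [mem_range_latticeConeExponent, mem_characterLattice]
      simp only [Units.val_eq_one]
      exact ⟨fun h g => h g⁻¹, fun h g => by simpa using h g⁻¹⟩)

/-- The lattice has rank n and all n coordinates are constrained, so s = 0 in `cls_latticeCone` and
no torus factor remains. -/
theorem cls_affineQuotient_of_isDiag [Finite G]
    (hG : ∀ g ∈ G, (g : Matrix (Fin n) (Fin n) k).IsDiag) :
    K0.cls (affineQuotient G) = lefschetz k ^ n := by
  -- Finite generation of the cone algebra comes from that of the ring of invariants.
  have := Algebra.FiniteType.equiv
    (finiteType_invariants ((linearAction k n).comp G.subtype)) (affineInvariantsEquiv G hG).symm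
  refine (K0.cls_specVar_congr (affineInvariantsEquiv G hG).symm).trans ?_
  rw [cls_latticeCone k Finset.univ _ 0 (fun i _ => exists_single_mem_characterLattice _ i)
    (by rw [finrank_characterLattice, Finset.card_univ, Fintype.card_fin, add_zero]),
    pow_zero, mul_one, Finset.card_univ, Fintype.card_fin]

/-- The quotient of a torus by a finite group of translations is a torus. -/
noncomputable def torusQuotientIso [Finite G]
    (hG : ∀ g ∈ G, (g : Matrix (Fin n) (Fin n) k).IsDiag) : torusQuotient G hG ≅ torus k n :=
  specVarIso (torusInvariantsEquiv (diagonalEntries G hG))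

end Diagonal

/-! ### Simultaneous diagonalization of finite abelian groups -/

section Diagonalization

variable {k : Type u} [Field k] {n : ℕ}

/-- Conjugate subgroups of `GLₙ(k)` have isomorphic rings of invariants. -/
noncomputable def affineInvariantsConjEquiv (G : Subgroup (GL (Fin n) k)) (P : GL (Fin n) k) :
    invariants ((linearAction k n).comp G.subtype) ≃ₐ[k]
      invariants ((linearAction k n).comp (G.map (MulAut.conj P).toMonoidHom).subtype) :=
  AlgEquiv.ofAlgHom
    (((linearAction k n P).comp (Subalgebra.val _)).codRestrict _ (by
      rintro ⟨f, hf⟩ ⟨_, g, hg, rfl⟩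
      change linearAction k n (P * g * P⁻¹) (linearAction k n P f) = linearAction k n P f
      rw [← AlgHom.mul_apply, ← map_mul, inv_mul_cancel_right, map_mul, AlgHom.mul_apply]
      exact congrArg _ (hf ⟨g, hg⟩)))
    (((linearAction k n P⁻¹).comp (Subalgebra.val _)).codRestrict _ (by
      rintro ⟨f, hf⟩ ⟨g, hg⟩
      change linearAction k n g (linearAction k n P⁻¹ f) = linearAction k n P⁻¹ f
      have : linearAction k n (P * g * P⁻¹) f = f := hf ⟨_, g, hg, rfl⟩
      conv_rhs => rw [← this]
      rw [← AlgHom.mul_apply, ← AlgHom.mul_apply, ← map_mul, ← map_mul]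
      congr 2
      group))
    (by
      refine AlgHom.ext fun f => Subtype.ext ?_
      change linearAction k n P (linearAction k n P⁻¹ f) = f
      rw [← AlgHom.mul_apply, ← map_mul, mul_inv_cancel, map_one, AlgHom.one_apply])
    (by
      refine AlgHom.ext fun f => Subtype.ext ?_
      change linearAction k n P⁻¹ (linearAction k n P f) = f
      rw [← AlgHom.mul_apply, ← map_mul, inv_mul_cancel, map_one, AlgHom.one_apply])

/-- In characteristic zero X^m - 1 is separable, hence squarefree, and it annihilates f. -/
lemma isSemisimple_of_pow_eq_one [CharZero k] {V : Type*} [AddCommGroup V] [Module k V]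
    {f : Module.End k V} {m : ℕ} (hm : m ≠ 0) (hf : f ^ m = 1) : f.IsSemisimple := by
  refine Module.End.isSemisimple_of_squarefree_aeval_eq_zero (p := Polynomial.X ^ m - 1)
    (Polynomial.X_pow_sub_one_separable_iff.mpr (Nat.cast_ne_zero.mpr hm)).squarefree ?_
  rw [map_sub, map_pow, Polynomial.aeval_X, map_one, hf, sub_self]

/-- Commuting endomorphisms of finite order have a basis of common eigenvectors. -/
lemma span_commonEigenvectors_eq_top [CharZero k] [IsAlgClosed k] {V : Type*} [AddCommGroup V]
    [Module k V] [FiniteDimensional k V] {ι : Type*} (f : ι → Module.End k V)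
    (hcomm : ∀ i j, Commute (f i) (f j)) (hfin : ∀ i, ∃ m : ℕ, m ≠ 0 ∧ f i ^ m = 1) :
    Submodule.span k {v | ∀ i, ∃ μ : k, f i v = μ • v} = ⊤ := by
  -- Joint generalized eigenspaces of a commuting family span; semisimplicity then turns them into
  -- joint eigenspaces.
  rw [eq_top_iff,
    ← Module.End.iSup_iInf_maxGenEigenspace_eq_top_of_iSup_maxGenEigenspace_eq_top_of_commute f
    (fun i j _ => hcomm i j) fun i => (f i).iSup_maxGenEigenspace_eq_top]
  refine iSup_le fun χ v hv => Submodule.subset_span fun i => ⟨χ i, ?_⟩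
  obtain ⟨m, hm, hmf⟩ := hfin i
  have h := (Submodule.mem_iInf _).mp hv i
  rw [(isSemisimple_of_pow_eq_one hm hmf).isFinitelySemisimple.maxGenEigenspace_eq_eigenspace] at h
  exact Module.End.mem_eigenspace_iff.mp h

/-- Finite abelian subgroups of `GLₙ(k)` are diagonalizable. -/
lemma exists_conj_isDiag [CharZero k] [IsAlgClosed k] (G : Subgroup (GL (Fin n) k)) [Finite G]
    (hG : ∀ g ∈ G, ∀ h ∈ G, g * h = h * g) :
    ∃ P : GL (Fin n) k, ∀ g ∈ G.map (MulAut.conj P).toMonoidHom,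
      (g : Matrix (Fin n) (Fin n) k).IsDiag := by
  let f (g : G) : Module.End k (Fin n → k) :=
    Matrix.toLinAlgEquiv' ((g : GL (Fin n) k) : Matrix (Fin n) (Fin n) k)
  have hspan := span_commonEigenvectors_eq_top f
    (fun g h => by
      change f g * f h = f h * f g
      rw [← map_mul, ← map_mul, ← Units.val_mul, ← Units.val_mul, hG g g.2 h h.2])
    (fun g => ⟨Nat.card G, Nat.card_pos.ne', by
      rw [← map_pow, ← Units.val_pow_eq_pow_val, ← Subgroup.coe_pow, pow_card_eq_one',
        Subgroup.coe_one, Units.val_one, map_one]⟩)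
  -- A basis chosen inside the spanning set consists of common eigenvectors.
  let b₀ := Module.Basis.ofSpan hspan.ge
  let b := b₀.reindex (b₀.indexEquiv (Pi.basisFun k (Fin n)))
  have hb (j : Fin n) (g : G) : ∃ μ : k, f g (b j) = μ • b j := by
    have : b j ∈ Set.range b₀ := by
      rw [Module.Basis.reindex_apply]
      exact ⟨_, rfl⟩
    exact Module.Basis.ofSpan_subset hspan.ge this g
  -- The columns of this matrix Q are the eigenvectors, so g Q = Q diag(μ) and conjugating by Q⁻¹
  -- diagonalizes g.
  have hunit : IsUnit (Matrix.of fun i j => b j i) :=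
    Matrix.linearIndependent_cols_iff_isUnit.mp b.linearIndependent
  obtain ⟨Q, hQ⟩ := hunit
  refine ⟨Q⁻¹, ?_⟩
  rintro _ ⟨g, hg, rfl⟩
  choose μ hμ using fun j => hb j ⟨g, hg⟩
  have hgQ : (g : Matrix (Fin n) (Fin n) k) * Q = Q * Matrix.diagonal μ := by
    ext i j
    rw [Matrix.mul_diagonal, hQ, mul_comm _ (μ j)]
    exact congrFun (hμ j) i
  have : (((MulAut.conj Q⁻¹).toMonoidHom g : GL (Fin n) k) : Matrix (Fin n) (Fin n) k) =
      Matrix.diagonal μ := by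
    change ((Q⁻¹ * g * Q⁻¹⁻¹ : GL (Fin n) k) : Matrix (Fin n) (Fin n) k) = _
    rw [inv_inv, mul_assoc, Units.val_mul, Units.val_mul, hgQ, Units.inv_mul_cancel_left]
  rw [this]
  exact Matrix.isDiag_diagonal μ

theorem cls_affineQuotient_of_commute [CharZero k] [IsAlgClosed k] (G : Subgroup (GL (Fin n) k))
    [Finite G] (hG : ∀ g ∈ G, ∀ h ∈ G, g * h = h * g) :
    K0.cls (affineQuotient G) = lefschetz k ^ n := by
  obtain ⟨P, hP⟩ := exists_conj_isDiag G hG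
  have : Finite (G.map (MulAut.conj P).toMonoidHom) :=
    Set.Finite.image _ (Set.toFinite (G : Set (GL (Fin n) k)))
  rw [← cls_affineQuotient_of_isDiag _ hP]
  exact K0.cls_specVar_congr (affineInvariantsConjEquiv G P)

end Diagonalization

end MotivicClass

theorem mainTheorem7 (n : ℕ) (G : Subgroup (GL (Fin n) ℂ)) [Finite G] :
    (∀ hG : ∀ g ∈ G, (g : Matrix (Fin n) (Fin n) ℂ).IsDiag,
      Nonempty (MotivicClass.torusQuotient G hG ≅ MotivicClass.torus ℂ n) ∧
      MotivicClass.K0.cls (MotivicClass.torusQuotient G hG) =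
        (MotivicClass.lefschetz ℂ - 1) ^ n) ∧
    ((∀ g ∈ G, ∀ h ∈ G, g * h = h * g) →
      MotivicClass.K0.cls (MotivicClass.affineQuotient G) = MotivicClass.lefschetz ℂ ^ n) :=
  ⟨fun hG => ⟨⟨MotivicClass.torusQuotientIso G hG⟩,
    (MotivicClass.K0.cls_eq_of_iso (MotivicClass.torusQuotientIso G hG)).trans
      (MotivicClass.K0.cls_torus ℂ n)⟩,
    MotivicClass.cls_affineQuotient_of_commute G⟩
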